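/- Let $n \ge 0$ and let $G = \mathrm{Sp}(2n,\mathbb C)$ be the group of $2n\times 2n$ complex matrices $g$ with $g J g^{\mathsf T} = J$, where $J = \begin{pmatrix} 0 & -I_n \\ I_n & 0\end{pmatrix}$, and let $T \subset G$ be the maximal torus of matrices $\mathrm{diag}(t_1,\dots,t_n,t_1^{-1},\dots,t_n^{-1})$, with characters $\epsilon_i\colon t \mapsto t_i$ and positive roots $R^+ = \{\epsilon_i \pm \epsilon_j\}_{i<j} \cup \{2\epsilon_i\}$. Let $V_1 = \mathbb C^{2n}$ be the vector representation with standard basis $e_1,\dots,e_{2n}$, let $V_2 = (\wedge^2 V_1)/\mathbb C\omega$, where $\omega = \sum_{i=1}^n e_i\wedge e_{n+i}$ is $G$-invariant, and let $\mathbb V = V_1\oplus V_2$. Let $\mathbb V[\lambda]$ denote the $T$-weight space of weight $\lambda \in X^*(T) = \bigoplus_i \mathbb Z\epsilon_i$, and put $$\mathbb V^+ = \bigoplus_{\lambda \in \mathbb Q_{\ge 0}R^+ \setminus\{0\}} \mathbb V[\lambda].$$ Let $B \supset T$ be the Borel subgroup of $G$ defined by $R^+$, and let the exotic nilpotent cone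 $\mathfrak N \subset \mathbb V$ be the image of the map $\mu\colon G\times^B \mathbb V^+ \to \mathbb V$, $[g,v]\mapsto gv$; that is, $\mathfrak N = G\cdot \mathbb V^+$. Then for every $X \in \mathfrak N$ the stabilizer $\{g\in G : gX = X\}$ is connected, both in the classical (complex) topology and in the Zariski topology of $G$. -/

import Mathlib

open scoped Matrix

noncomputable section

namespace ExoticNilpotentCone

/-- The complex symplectic group `Sp(2n, ℂ)`: the matrices `g` with `g J gᵀ = J`, where
`J = (0, -1; 1, 0)`. -/
abbrev G (n : ℕ) : Type := Matrix.symplecticGroup (Fin n) ℂ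

/-- The vector representation `V₁ = ℂ²ⁿ`, as column vectors indexed by `Fin n ⊕ Fin n`. -/
abbrev V₁ (n : ℕ) : Type := Fin n ⊕ Fin n → ℂ

/-- The standard basis vector `e_a` of `V₁`. -/
def e {n : ℕ} (a : Fin n ⊕ Fin n) : V₁ n := Pi.single a 1

/-- The decomposable element `v ∧ w` of `⋀² V₁`. -/
def wedge {n : ℕ} (v w : V₁ n) : ⋀[ℂ]^2 (V₁ n) := exteriorPower.ιMulti ℂ 2 ![v, w]

/-- The `Sp(2n)`-invariant bivector `∑ᵢ eᵢ ∧ e_{n+i}`. -/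
def ω (n : ℕ) : ⋀[ℂ]^2 (V₁ n) := ∑ i : Fin n, wedge (e (Sum.inl i)) (e (Sum.inr i))

/-- `V₂ = (⋀² V₁) / ℂ`, the quotient by the trivial submodule `ℂ ω`. -/
abbrev V₂ (n : ℕ) : Type := (⋀[ℂ]^2 (V₁ n)) ⧸ (Submodule.span ℂ {ω n})

/-- `𝕍 = V₁ ⊕ V₂`. -/
abbrev V (n : ℕ) : Type := V₁ n × V₂ n

/-- The action of `G` on `V₁`: multiplication of column vectors by matrices. -/
def ρ₁ (n : ℕ) : Representation ℂ (G n) (V₁ n) where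
  toFun g := Matrix.mulVecLin (g : Matrix (Fin n ⊕ Fin n) (Fin n ⊕ Fin n) ℂ)
  map_one' := by simp; rfl
  map_mul' g h := by simp [Matrix.mulVecLin_mul]; rfl

/-- The action of `G` on `⋀² V₁`, characterised by `g (v ∧ w) = (g v) ∧ (g w)`. -/
def ρΛ (n : ℕ) : Representation ℂ (G n) (⋀[ℂ]^2 (V₁ n)) where
  toFun g := exteriorPower.map 2 (ρ₁ n g)
  map_one' := by rw [map_one]; exact exteriorPower.map_id
  map_mul' g h := by rw [map_mul]; exact exteriorPower.map_comp (n := 2) (ρ₁ n h) (ρ₁ n g)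

lemma ρΛ_wedge {n : ℕ} (g : G n) (v w : V₁ n) :
    ρΛ n g (wedge v w) = wedge (ρ₁ n g v) (ρ₁ n g w) := by
  change exteriorPower.map 2 (ρ₁ n g) (exteriorPower.ιMulti ℂ 2 ![v, w]) = _
  rw [exteriorPower.map_apply_ιMulti, wedge]
  congr 1
  funext i
  fin_cases i <;> rfl

lemma wedge_swap {n : ℕ} (v w : V₁ n) : wedge w v = - wedge v w := by
  have h := (exteriorPower.ιMulti ℂ 2 (M := V₁ n)).map_swap ![v, w]
    (show (0 : Fin 2) ≠ 1 by decide)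
  have h2 : (![v, w] ∘ Equiv.swap (0 : Fin 2) 1) = ![w, v] := by
    funext i; fin_cases i <;> simp
  rw [h2] at h
  exact h

/-- `wedge` as a bilinear map. -/
def wedgeₗ (n : ℕ) : V₁ n →ₗ[ℂ] V₁ n →ₗ[ℂ] ⋀[ℂ]^2 (V₁ n) :=
  have upd : ∀ v w : V₁ n, Function.update ![v, 0] 1 w = ![v, w] := by
    intro v w
    funext i
    fin_cases i <;> simp
  have add_right : ∀ v w w' : V₁ n, wedge v (w + w') = wedge v w + wedge v w' := by
    intro v w w'
    have := (exteriorPower.ιMulti ℂ 2 (M := V₁ n)).map_update_add ![v, 0] 1 w w'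
    rwa [upd, upd, upd] at this
  have smul_right : ∀ (c : ℂ) (v w : V₁ n), wedge v (c • w) = c • wedge v w := by
    intro c v w
    have := (exteriorPower.ιMulti ℂ 2 (M := V₁ n)).map_update_smul ![v, 0] 1 c w
    rwa [upd, upd] at this
  LinearMap.mk₂ ℂ wedge
    (fun v v' w => by
      rw [wedge_swap w, add_right, wedge_swap v w, wedge_swap v' w, neg_add, neg_neg, neg_neg])
    (fun c v w => by
      rw [wedge_swap w, smul_right, wedge_swap v w, smul_neg, neg_neg])
    add_right smul_right

lemma wedgeₗ_apply {n : ℕ} (v w : V₁ n) : wedgeₗ n v w = wedge v w := rfl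

lemma ρ₁_e {n : ℕ} (g : G n) (a : Fin n ⊕ Fin n) :
    ρ₁ n g (e a) = ∑ c, g.1 c a • e c := by
  change g.1 *ᵥ Pi.single a 1 = _
  ext c
  simp [e, Pi.single_apply]

lemma sum_J_smul {n : ℕ} {M : Type*} [AddCommGroup M] [Module ℂ M]
    (w : Fin n ⊕ Fin n → Fin n ⊕ Fin n → M)
    (h : ∀ i, w (Sum.inr i) (Sum.inl i) = - w (Sum.inl i) (Sum.inr i)) :
    ∑ a, ∑ b, Matrix.J (Fin n) ℂ a b • w a b =
      (-2 : ℂ) • ∑ i, w (Sum.inl i) (Sum.inr i) := by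
  simp only [Matrix.J, Fintype.sum_sum_type, Matrix.fromBlocks_apply₁₁,
    Matrix.fromBlocks_apply₁₂, Matrix.fromBlocks_apply₂₁, Matrix.fromBlocks_apply₂₂,
    Matrix.zero_apply, Matrix.neg_apply, Matrix.one_apply, zero_smul, neg_smul, ite_smul,
    one_smul, Finset.sum_neg_distrib, Finset.sum_ite_eq, Finset.mem_univ, if_true,
    Finset.sum_const_zero, zero_add, add_zero, h]
  module

lemma sum_J_wedge (n : ℕ) :
    ∑ a, ∑ b, Matrix.J (Fin n) ℂ a b • wedge (e a) (e b) = (-2 : ℂ) • ω n :=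
  sum_J_smul (fun a b => wedge (e a) (e b)) fun _ => wedge_swap _ _

lemma ρΛ_sum_J {n : ℕ} (g : G n) :
    ρΛ n g (∑ a, ∑ b, Matrix.J (Fin n) ℂ a b • wedge (e a) (e b)) =
      ∑ a, ∑ b, Matrix.J (Fin n) ℂ a b • wedge (e a) (e b) := by
  have key : ∀ c d, Matrix.J (Fin n) ℂ c d =
      ∑ a, ∑ b, Matrix.J (Fin n) ℂ a b * (g.1 c a * g.1 d b) := by
    intro c d
    have hg := SymplecticGroup.mem_iff.1 g.2
    conv_lhs => rw [← hg]
    simp only [Matrix.mul_apply, Matrix.transpose_apply, Finset.sum_mul]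
    rw [Finset.sum_comm]
    exact Finset.sum_congr rfl fun a _ => Finset.sum_congr rfl fun b _ => by ring
  have lhs : ρΛ n g (∑ a, ∑ b, Matrix.J (Fin n) ℂ a b • wedge (e a) (e b)) =
      ∑ a, ∑ b, ∑ c, ∑ d,
        (Matrix.J (Fin n) ℂ a b * (g.1 c a * g.1 d b)) • wedge (e c) (e d) := by
    simp only [map_sum, map_smul, ρΛ_wedge, ρ₁_e]
    refine Finset.sum_congr rfl fun a _ => Finset.sum_congr rfl fun b _ => ?_
    rw [← wedgeₗ_apply]
    simp only [map_sum, map_smul, LinearMap.sum_apply, LinearMap.smul_apply, wedgeₗ_apply,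
      Finset.smul_sum, smul_smul]
    rw [Finset.sum_comm]
    exact Finset.sum_congr rfl fun c _ => Finset.sum_congr rfl fun d _ => by congr 1; ring
  rw [lhs]
  have rhs : ∑ c, ∑ d, Matrix.J (Fin n) ℂ c d • wedge (e c) (e d) =
      ∑ c, ∑ d, ∑ a, ∑ b,
        (Matrix.J (Fin n) ℂ a b * (g.1 c a * g.1 d b)) • wedge (e c) (e d) := by
    refine Finset.sum_congr rfl fun c _ => Finset.sum_congr rfl fun d _ => ?_
    rw [key c d]
    simp only [Finset.sum_smul]
  rw [rhs]
  calc _ = ∑ a, ∑ c, ∑ b, ∑ d,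
        (Matrix.J (Fin n) ℂ a b * (g.1 c a * g.1 d b)) • wedge (e c) (e d) :=
        Finset.sum_congr rfl fun a _ => Finset.sum_comm
    _ = ∑ c, ∑ a, ∑ b, ∑ d,
        (Matrix.J (Fin n) ℂ a b * (g.1 c a * g.1 d b)) • wedge (e c) (e d) := Finset.sum_comm
    _ = ∑ c, ∑ a, ∑ d, ∑ b,
        (Matrix.J (Fin n) ℂ a b * (g.1 c a * g.1 d b)) • wedge (e c) (e d) :=
        Finset.sum_congr rfl fun c _ => Finset.sum_congr rfl fun a _ => Finset.sum_comm
    _ = _ := Finset.sum_congr rfl fun c _ => Finset.sum_comm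

lemma ρΛ_ω {n : ℕ} (g : G n) : ρΛ n g (ω n) = ω n := by
  have h := ρΛ_sum_J g
  rw [sum_J_wedge, map_smul] at h
  exact smul_right_injective _ (by norm_num : (-2 : ℂ) ≠ 0) h

lemma span_ω_le_comap {n : ℕ} (g : G n) :
    Submodule.span ℂ {ω n} ≤ (Submodule.span ℂ {ω n}).comap (ρΛ n g) := by
  rw [Submodule.span_le, Set.singleton_subset_iff]
  change ρΛ n g (ω n) ∈ Submodule.span ℂ {ω n}
  rw [ρΛ_ω]
  exact Submodule.mem_span_singleton_self _

/-- The action of `G` on `V₂ = (⋀² V₁) / ℂ ω` induced from `⋀² V₁`. -/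
def ρ₂ (n : ℕ) : Representation ℂ (G n) (V₂ n) where
  toFun g := Submodule.mapQ _ _ (ρΛ n g) (span_ω_le_comap g)
  map_one' := by
    ext x
    simp
  map_mul' g h := by
    ext x
    simp

/-- The action of `G` on `𝕍 = V₁ ⊕ V₂`. -/
def ρ (n : ℕ) : Representation ℂ (G n) (V n) := (ρ₁ n).prod (ρ₂ n)

/-- The element `diag(t₁, …, tₙ, t₁⁻¹, …, tₙ⁻¹)` of the diagonal maximal torus `T` of `G`. -/
def torus {n : ℕ} (t : Fin n → ℂˣ) : G n :=
  ⟨Matrix.diagonal (Sum.elim (fun i => (t i : ℂ)) (fun i => ((t i)⁻¹ : ℂˣ))), by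
    rw [SymplecticGroup.mem_iff]
    ext (i | i) (j | j) <;>
      simp [Matrix.J, Matrix.diagonal_transpose, Matrix.diagonal_mul, Matrix.mul_diagonal,
        Matrix.one_apply] <;> (by_cases h : i = j <;> simp [h])⟩

/-- The weight space `𝕍[λ]` with respect to `T`, for the character
`λ = ∑ᵢ λᵢ εᵢ : t ↦ ∏ᵢ tᵢ ^ λᵢ` in `X^*(T) = ℤⁿ`. -/
def weightSpace {n : ℕ} (l : Fin n → ℤ) : Submodule ℂ (V n) :=
  ⨅ t : Fin n → ℂˣ,
    LinearMap.ker (ρ n (torus t) - ((∏ i, t i ^ l i : ℂˣ) : ℂ) • LinearMap.id)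

/-- The basis vector `εᵢ` of the space in which the roots live. -/
def ε {n : ℕ} (i : Fin n) : Fin n → ℚ := Pi.single i 1

/-- The positive roots `R⁺ = {εᵢ ± εⱼ}_{i < j} ∪ {2 εᵢ}`. -/
def posRoots (n : ℕ) : Set (Fin n → ℚ) :=
  {α | (∃ i j : Fin n, i < j ∧ (α = ε i + ε j ∨ α = ε i - ε j)) ∨ ∃ i : Fin n, α = 2 • ε i}

/-- The characters lying in `ℚ_{≥0} R⁺ - {0}`. -/
def posWeights (n : ℕ) : Set (Fin n → ℤ) :=
  {l | (fun i => (l i : ℚ)) ∈ Submodule.span ℚ≥0 (posRoots n) ∧ l ≠ 0}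

/-- The positive part `𝕍⁺ = ⨁_{λ ∈ ℚ_{≥0} R⁺ - {0}} 𝕍[λ]`. -/
def positivePart (n : ℕ) : Submodule ℂ (V n) := ⨆ l ∈ posWeights n, weightSpace l

/-- The exotic nilpotent cone `𝔑`: the image of `μ : G ×^B 𝕍⁺ → 𝕍`, `[g, v] ↦ g v`, that is,
`𝔑 = G · 𝕍⁺`. -/
def nilcone (n : ℕ) : Set (V n) :=
  Set.range fun p : G n × positivePart n => ρ n p.1 p.2

/-- The stabilizer of `X ∈ 𝕍` in `G`. -/
def stabilizer {n : ℕ} (X : V n) : Subgroup (G n) where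
  carrier := {g | ρ n g X = X}
  one_mem' := by simp
  mul_mem' {g h} hg hh := by
    change ρ n (g * h) X = X
    rw [map_mul, Module.End.mul_apply, show ρ n h X = X from hh]
    exact hg
  inv_mem' {g} hg := by
    change ρ n g⁻¹ X = X
    conv_lhs => rw [← show ρ n g X = X from hg]
    simp

/-- The Zariski topology of `G`: the sets `{g | p(g) ≠ 0}`, for polynomials `p` in the matrix
entries, form a basis of open sets. -/
@[reducible]
def zariski (n : ℕ) : TopologicalSpace (G n) :=
  TopologicalSpace.generateFrom
    {U | ∃ p : MvPolynomial ((Fin n ⊕ Fin n) × (Fin n ⊕ Fin n)) ℂ,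
      U = {g : G n | MvPolynomial.eval (fun ab => g.1 ab.1 ab.2) p ≠ 0}}

/-- A subset of `G` is connected in the Zariski topology. -/
def IsZariskiConnected {n : ℕ} (S : Set (G n)) : Prop := @IsConnected (G n) (zariski n) S

end ExoticNilpotentCone

end

/-!
A point of `𝕍` is a pair of a vector `v` and a bivector modulo `ω`. Multiplying the coefficient
matrix of the bivector by `J` gives an endomorphism `x` that is self-adjoint for the symplectic
form, `ω` becomes a scalar, and the stabilizer becomes the set `S` of `g ∈ Sp(2n)` that commute
with `x` and fix `v` (`image_stabilizer`). The set `S` is path connected for every self-adjoint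
`x`, and this gives the result in both topologies, the Zariski topology being the coarser one.

Write `A*` for the adjoint of a matrix. If an invertible `D` commutes with `x` and with `D*`, and
`D* v = D v`, then `D* D⁻¹` lies in `S`; since the conditions are linear along the line through
`1` and `D`, and that line meets the singular matrices in finitely many points, `D* D⁻¹` is joined
to `1` within `S` (`joinedIn_one_adj_mul_inv`). Two choices of `D` suffice.

* If `-1` is not an eigenvalue of `k ∈ S`, then `D = 1 + k⁻¹` yields `k`: this is the Cayley
  transform (`joinedIn_one_of_det_one_add`).
* For general `g ∈ S`, let `π` be the projection onto the generalized eigenspace of `g` for `-1`.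
  It is a polynomial in the self-adjoint matrix `g + g⁻¹ + 2`, so it is self-adjoint and commutes
  with `x`; also `π v = 0`, because `g v = v`. The matrix `k = g (1 - 2 π)` has no eigenvalue
  `-1`, and it remains to join `1 - 2 π` to `1` (`joinedIn_one_reflection`). This takes an
  invertible skew-adjoint operator on the image of `π` that commutes with `x`, or equivalently a
  nondegenerate symmetric form there for which `x` is self-adjoint. Such a form exists for every
  endomorphism of a finite-dimensional space, since the associated module over the polynomial
  ring is a direct sum of modules `K[X] / (q)`, which are Frobenius algebras
  (`exists_isSymm_separatingLeft_selfAdjoint`).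

The second step is where the symplectic group differs from the orthogonal group: there the same
operator would have to be skew for a symmetric form, and in general the eigenvalue `-1` cannot be
removed.
-/

namespace ExoticNilpotentCone

open Polynomial

/-! ### Symmetric forms and Fitting projections of an endomorphism -/

/-- `K[X] / (q)` is a Frobenius algebra: the functional reading off the top coefficient of the
reduced representative does not vanish on any nonzero ideal. -/
lemma exists_functional_quotient_span {K : Type*} [Field K] {q : K[X]} (hq : q ≠ 0) :
    ∃ l : (K[X] ⧸ Ideal.span {q}) →ₗ[K] K, ∀ a ≠ 0, ∃ b, l (a * b) ≠ 0 := by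
  classical
  have hm : (normalize q).Monic := monic_normalize hq
  have hspan : Ideal.span {q} = Ideal.span {normalize q} :=
    Ideal.span_singleton_eq_span_singleton.2 (associated_normalize q)
  rw [hspan]
  -- `m` is the monic associate of `q`
  generalize normalize q = m at hm
  let l₀ : K[X] →ₗ[K] K := lcoeff K (m.natDegree - 1) ∘ₗ modByMonicHom m
  let l : (K[X] ⧸ Ideal.span {m}) →ₗ[K] K :=
    ((Ideal.span {m}).restrictScalars K).liftQ l₀ (by
      intro p hp
      have hp' : m ∣ p := Ideal.mem_span_singleton.1 hp
      have : p %ₘ m = 0 := (modByMonic_eq_zero_iff_dvd hm).2 hp'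
      simp [l₀, modByMonicHom, this])
  refine ⟨l, fun a ha => ?_⟩
  obtain ⟨p, rfl⟩ := Ideal.Quotient.mk_surjective a
  set r := p %ₘ m with hr
  have hmk : Ideal.Quotient.mk (Ideal.span {m}) p = Ideal.Quotient.mk (Ideal.span {m}) r := by
    rw [Ideal.Quotient.mk_eq_mk_iff_sub_mem, Ideal.mem_span_singleton]
    refine ⟨p /ₘ m, ?_⟩
    have := modByMonic_add_div p m
    linear_combination (exp := 1) -this
  have hr0 : r ≠ 0 := by
    rintro h
    apply ha
    rw [hmk, h, map_zero]
  have hm1 : m ≠ 1 := by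
    rintro rfl
    simp at hr
    exact hr0 hr
  have hdeg : r.natDegree < m.natDegree := natDegree_modByMonic_lt p hm hm1
  refine ⟨Ideal.Quotient.mk _ (X ^ (m.natDegree - 1 - r.natDegree)), ?_⟩
  rw [hmk, ← map_mul]
  change l₀ (r * X ^ _) ≠ 0
  have hlt : (r * X ^ (m.natDegree - 1 - r.natDegree)).degree < m.degree := by
    rw [degree_eq_natDegree hm.ne_zero, degree_eq_natDegree (by simp [hr0]),
      natDegree_mul_X_pow (hp := hr0)]
    norm_cast
    omega
  have : l₀ (r * X ^ (m.natDegree - 1 - r.natDegree)) = r.leadingCoeff := by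
    simp only [l₀, modByMonicHom, LinearMap.comp_apply, LinearMap.coe_mk, AddHom.coe_mk,
      (modByMonic_eq_self_iff hm).2 hlt, lcoeff_apply]
    conv_lhs => rw [show m.natDegree - 1 = r.natDegree + (m.natDegree - 1 - r.natDegree) by omega]
    rw [Nat.add_sub_cancel_left, coeff_mul_X_pow]
    rfl
  rw [this]
  exact leadingCoeff_ne_zero.2 hr0

/-- Every endomorphism of a finite-dimensional space is self-adjoint for some nondegenerate
symmetric bilinear form: the `K[X]`-module it defines is a sum of cyclic modules `K[X] / (q)`,
and each of these is a Frobenius algebra. -/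
theorem exists_isSymm_separatingLeft_selfAdjoint {K U : Type*} [Field K] [AddCommGroup U]
    [Module K U] [FiniteDimensional K U] (x : Module.End K U) :
    ∃ B : LinearMap.BilinForm K U, (∀ u w, B u w = B w u) ∧
      (∀ u w, B (x u) w = B u (x w)) ∧ B.SeparatingLeft := by
  classical
  obtain ⟨ι, _, p, hp, k, ⟨f⟩⟩ := Module.equiv_directSum_of_isTorsion
    (Module.AEval.isTorsion_of_finiteDimensional K U x)
  choose l hl using fun i => exists_functional_quotient_span (pow_ne_zero (k i) (hp i).ne_zero)
  let F : U → ∀ i, K[X] ⧸ Ideal.span {p i ^ k i} := fun u i => f (Module.AEval'.of x u) i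
  have hx : ∀ u i, F (x u) i = Ideal.Quotient.mk _ X * F u i := by
    intro u i
    change f (Module.AEval'.of x (x u)) i = _
    rw [← Module.AEval'.X_smul_of, map_smul]
    rfl
  have hadd : ∀ u w, F (u + w) = F u + F w := by
    intro u w
    funext i
    simp [F]
  have hsmul : ∀ (c : K) u, F (c • u) = c • F u := by
    intro c u
    funext i
    change f (Module.AEval'.of x (c • u)) i = _
    rw [map_smul, ← Module.AEval.C_smul, map_smul]
    change C c • F u i = c • F u i
    rw [← algebraMap_eq, algebraMap_smul]
  refine ⟨LinearMap.mk₂ K (fun u w => ∑ i, l i (F u i * F w i)) ?_ ?_ ?_ ?_,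
    fun u w => ?_, fun u w => ?_, fun u hu => ?_⟩
  · simp [hadd, add_mul, Finset.sum_add_distrib]
  · intro c u w
    simp only [hsmul, Pi.smul_apply, smul_mul_assoc, map_smul, Finset.smul_sum]
  · simp [hadd, mul_add, Finset.sum_add_distrib]
  · intro c u w
    simp only [hsmul, Pi.smul_apply, mul_smul_comm, map_smul, Finset.smul_sum]
  · simp only [LinearMap.mk₂_apply, mul_comm]
  · simp only [LinearMap.mk₂_apply, hx]
    exact Finset.sum_congr rfl fun i _ => by ring_nf
  · by_contra hu0
    obtain ⟨i, hi⟩ : ∃ i, F u i ≠ 0 := by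
      by_contra! h
      have h0 : f (Module.AEval'.of x u) = 0 := DFinsupp.ext h
      exact hu0 (by simpa using h0)
    obtain ⟨b, hb⟩ := hl i _ hi
    have hF : ∀ j, F ((Module.AEval'.of x).symm (f.symm (DirectSum.of _ i b))) j =
        (DirectSum.of (fun j => K[X] ⧸ Ideal.span {p j ^ k j}) i b) j := by
      intro j
      simp only [F, LinearEquiv.apply_symm_apply]
    apply hb
    rw [← hu ((Module.AEval'.of x).symm (f.symm (DirectSum.of _ i b))), LinearMap.mk₂_apply,
      Finset.sum_eq_single i]
    · rw [hF, DirectSum.of_eq_same]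
    · intro j _ hj
      rw [hF, DirectSum.of_eq_of_ne _ _ _ hj, mul_zero, map_zero]
    · simp

/-- For a projection `π` commuting with `x`, there is a symmetric matrix `S`, living on the image
of `π` and nondegenerate there, for which `x` is self-adjoint. -/
theorem exists_symm_matrix_selfAdjoint {K ι : Type*} [Field K] [Fintype ι] [DecidableEq ι]
    {π x : Matrix ι ι K} (hπ : π * π = π) (hx : π * x = x * π) :
    ∃ S : Matrix ι ι K, Sᵀ = S ∧ xᵀ * S = S * x ∧ S * π = S ∧
      ∀ u, S *ᵥ u = 0 → π *ᵥ u = 0 := by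
  let U := LinearMap.range π.mulVecLin
  let P : (ι → K) →ₗ[K] U := π.mulVecLin.rangeRestrict
  have hU : ∀ u ∈ U, x.mulVecLin u ∈ U := by
    rintro _ ⟨u, rfl⟩
    exact ⟨x *ᵥ u, by simp [Matrix.mulVec_mulVec, hx]⟩
  let x' : Module.End K U := x.mulVecLin.restrict hU
  have hP : ∀ u, P (x *ᵥ u) = x' (P u) := fun u =>
    Subtype.ext (by simp [P, x', Matrix.mulVec_mulVec, hx])
  have hPπ : ∀ u, P (π *ᵥ u) = P u := fun u =>
    Subtype.ext (by simp [P, Matrix.mulVec_mulVec, hπ])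
  obtain ⟨B, hsymm, hself, hsep⟩ := exists_isSymm_separatingLeft_selfAdjoint x'
  let B' : LinearMap.BilinForm K (ι → K) := B.comp P P
  have hB' : ∀ u w, u ⬝ᵥ (LinearMap.BilinForm.toMatrix' B' *ᵥ w) = B (P u) (P w) := by
    intro u w
    rw [← Matrix.toBilin'_apply', Matrix.toBilin'_toMatrix']
    rfl
  have hext : ∀ A C : Matrix ι ι K, (∀ u w, u ⬝ᵥ (A *ᵥ w) = u ⬝ᵥ (C *ᵥ w)) → A = C := by
    intro A C h
    refine Matrix.ext_of_mulVec_single fun i => ?_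
    exact dotProduct_eq _ _ fun w => by rw [dotProduct_comm, h, dotProduct_comm]
  refine ⟨LinearMap.BilinForm.toMatrix' B', hext _ _ fun u w => ?_, hext _ _ fun u w => ?_,
    hext _ _ fun u w => ?_, fun u hu => ?_⟩
  · rw [Matrix.mulVec_transpose, dotProduct_comm, ← Matrix.dotProduct_mulVec, hB', hB', hsymm]
  · rw [← Matrix.mulVec_mulVec, ← Matrix.mulVec_mulVec, Matrix.dotProduct_mulVec,
      Matrix.vecMul_transpose, hB', hB', hP, hP, hself]
  · rw [← Matrix.mulVec_mulVec, hB', hB', hPπ]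
  · have : P u = 0 := hsep _ fun w => by
      obtain ⟨w, rfl⟩ := π.mulVecLin.surjective_rangeRestrict w
      change B (P u) (P w) = 0
      rw [hsymm, ← hB', hu, dotProduct_zero]
    exact congrArg Subtype.val this

/-- Fitting decomposition: the projection onto the generalized kernel of `y` along the image of a
high power of `y` is a polynomial in `y`. -/
theorem exists_fitting_projection {K A : Type*} [Field K] [Ring A] [Algebra K A]
    [FiniteDimensional K A] (y : A) :
    ∃ p c : K[X], aeval y p * aeval y p = aeval y p ∧ (∃ N, y ^ N * aeval y p = 0) ∧
      1 - aeval y p = aeval y c * y := by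
  -- the extra factor `X` makes the multiplicity of the root `0` positive
  have hm0 : X * minpoly K y ≠ 0 := mul_ne_zero X_ne_zero (minpoly.ne_zero_of_finite K y)
  obtain ⟨q, hq, hdvd⟩ := exists_eq_pow_rootMultiplicity_mul_and_not_dvd _ hm0 0
  have hN : 0 < rootMultiplicity 0 (X * minpoly K y) :=
    (rootMultiplicity_pos hm0).2 (by simp)
  generalize rootMultiplicity 0 (X * minpoly K y) = N at hq hN
  rw [C_0, sub_zero] at hq hdvd
  have hcop : IsCoprime (X ^ N) q :=
    IsCoprime.pow_left ((irreducible_X.coprime_iff_not_dvd).2 hdvd)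
  obtain ⟨a, b, hab⟩ := hcop
  have hzero : aeval y (X ^ N * q) = 0 := by rw [← hq, map_mul, minpoly.aeval, mul_zero]
  refine ⟨b * q, a * X ^ (N - 1), ?_, ⟨N, ?_⟩, ?_⟩
  · rw [← map_mul, ← sub_eq_zero, ← map_sub]
    have : b * q * (b * q) - b * q = -(a * b) * (X ^ N * q) := by
      linear_combination (b * q) * hab
    rw [this, map_mul, hzero, mul_zero]
  · have : y ^ N = aeval y (X ^ N : K[X]) := by simp
    rw [this, ← map_mul, show X ^ N * (b * q) = b * (X ^ N * q) by ring, map_mul, hzero, mul_zero]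
  · have h1 : aeval y (a * X ^ (N - 1)) * y = aeval y (a * X ^ N) := by
      conv_rhs => rw [← Nat.sub_add_cancel hN, pow_succ, ← mul_assoc, map_mul, aeval_X]
    rw [h1, eq_comm, eq_sub_iff_add_eq, ← map_add, hab, map_one]

/-! ### The symplectic adjoint -/

/-- Square complex matrices of size `2n`, indexed as the elements of `G n` are. -/
abbrev Mat (n : ℕ) : Type := Matrix (Fin n ⊕ Fin n) (Fin n ⊕ Fin n) ℂ

variable {n : ℕ}

/-- The adjoint `A* = J Aᵀ J⁻¹` of a matrix with respect to the symplectic form; here `J⁻¹ = -J`.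
For `g ∈ Sp(2n)` it is the inverse of `g`. -/
def adj (A : Mat n) : Mat n := -(Matrix.J (Fin n) ℂ * Aᵀ * Matrix.J (Fin n) ℂ)

lemma J_mul_J_mul (A : Mat n) : Matrix.J (Fin n) ℂ * (Matrix.J (Fin n) ℂ * A) = -A := by
  rw [← mul_assoc, Matrix.J_squared, neg_one_mul]

lemma adj_mul (A B : Mat n) : adj (A * B) = adj B * adj A := by
  simp [adj, mul_assoc, J_mul_J_mul, Matrix.transpose_mul]

lemma adj_adj (A : Mat n) : adj (adj A) = A := by
  simp [adj, mul_assoc, J_mul_J_mul, Matrix.transpose_mul, Matrix.J_squared]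

lemma adj_one : adj (1 : Mat n) = 1 := by
  simp [adj, Matrix.J_squared]

lemma adj_add (A B : Mat n) : adj (A + B) = adj A + adj B := by
  simp [adj, Matrix.mul_add, Matrix.add_mul, add_comm]

lemma adj_smul (c : ℂ) (A : Mat n) : adj (c • A) = c • adj A := by
  simp [adj]

lemma adj_sub (A B : Mat n) : adj (A - B) = adj A - adj B := by
  rw [sub_eq_add_neg, adj_add, ← neg_one_smul ℂ B, adj_smul, neg_one_smul, sub_eq_add_neg]

lemma adj_aeval {y : Mat n} (hy : adj y = y) (p : ℂ[X]) : adj (aeval y p) = aeval y p := by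
  have hpow : ∀ k : ℕ, adj (y ^ k) = y ^ k := by
    intro k
    induction k with
    | zero => simp [adj_one]
    | succ k ih => rw [pow_succ, adj_mul, ih, hy, ← pow_succ', pow_succ]
  induction p using Polynomial.induction_on' with
  | add p q hp hq => rw [map_add, adj_add, hp, hq]
  | monomial k a => rw [aeval_monomial, ← Algebra.smul_def, adj_smul, hpow]

lemma adj_J_mul {S : Mat n} (hS : Sᵀ = S) :
    adj (Matrix.J (Fin n) ℂ * S) = -(Matrix.J (Fin n) ℂ * S) := by
  simp [adj, mul_assoc, hS, Matrix.transpose_mul, Matrix.J_squared]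

lemma mem_symplecticGroup_iff_mul_adj {g : Mat n} :
    g ∈ Matrix.symplecticGroup (Fin n) ℂ ↔ g * adj g = 1 := by
  rw [SymplecticGroup.mem_iff, adj]
  constructor
  · intro h
    rw [mul_neg, ← mul_assoc, ← mul_assoc, h, Matrix.J_squared, neg_neg]
  · intro h
    have h2 := congrArg (fun A => A * Matrix.J (Fin n) ℂ) h
    simp only [mul_neg, neg_mul, mul_assoc, Matrix.J_squared, mul_one, neg_neg, one_mul] at h2
    rw [mul_assoc, h2]

/-! ### Paths in the centralizer of a self-adjoint matrix and a vector -/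

/-- The symplectic matrices that commute with `x` and fix `v`. For self-adjoint `x` this is the
stabilizer of a point of `𝕍`, viewed inside the space of matrices. -/
def unitaryStabilizer (x : Mat n) (v : V₁ n) : Set (Mat n) :=
  {g | g * adj g = 1 ∧ g * x = x * g ∧ g *ᵥ v = v}

lemma one_mem_unitaryStabilizer (x : Mat n) (v : V₁ n) : 1 ∈ unitaryStabilizer x v :=
  ⟨by simp [adj_one], by simp, by simp⟩

lemma mul_mem_unitaryStabilizer {x : Mat n} {v : V₁ n} {g h : Mat n}
    (hg : g ∈ unitaryStabilizer x v) (hh : h ∈ unitaryStabilizer x v) :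
    g * h ∈ unitaryStabilizer x v := by
  refine ⟨?_, ?_, ?_⟩
  · rw [adj_mul, mul_assoc, ← mul_assoc h, hh.1, one_mul, hg.1]
  · rw [mul_assoc, hh.2.1, ← mul_assoc, hg.2.1, mul_assoc]
  · rw [← Matrix.mulVec_mulVec, hh.2.2, hg.2.2]

lemma adj_mul_inv_mem {x P : Mat n} {v : V₁ n} (hx : adj x = x) (hP : IsUnit P.det)
    (hPx : P * x = x * P) (hPP : P * adj P = adj P * P) (hv : adj P *ᵥ v = P *ᵥ v) :
    adj P * P⁻¹ ∈ unitaryStabilizer x v := by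
  have h1 : P * P⁻¹ = 1 := Matrix.mul_nonsing_inv P hP
  have h2 : P⁻¹ * P = 1 := Matrix.nonsing_inv_mul P hP
  have hcomm : ∀ A, P * A = A * P → A * P⁻¹ = P⁻¹ * A := by
    intro A hA
    calc A * P⁻¹ = P⁻¹ * (P * A) * P⁻¹ := by rw [← mul_assoc P⁻¹, h2, one_mul]
      _ = P⁻¹ * A := by rw [hA, mul_assoc, mul_assoc, h1, mul_one]
  have hQx : adj P * x = x * adj P := by
    have := congrArg adj hPx
    rw [adj_mul, adj_mul, hx] at this
    exact this.symm
  refine ⟨?_, ?_, ?_⟩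
  · rw [adj_mul, adj_adj, hcomm _ hPP, mul_assoc, ← mul_assoc (adj P), ← adj_mul, h2, adj_one,
      one_mul, h2]
  · rw [mul_assoc, ← hcomm _ hPx, ← mul_assoc, hQx, mul_assoc]
  · rw [hcomm _ hPP, ← Matrix.mulVec_mulVec, hv, Matrix.mulVec_mulVec, h2, Matrix.one_mulVec]

/-- The complex line through `1` and `D` consists of matrices satisfying the same equations as `D`,
and `P ↦ P* P⁻¹` sends those of them that are invertible into the stabilizer. Only finitely many
points of that line are singular, so the image of the rest joins `1` to
`D* D⁻¹`. -/
theorem joinedIn_one_adj_mul_inv {x D : Mat n} {v : V₁ n} (hx : adj x = x) (hD : IsUnit D.det)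
    (hDx : D * x = x * D) (hDD : D * adj D = adj D * D) (hv : adj D *ᵥ v = D *ᵥ v) :
    JoinedIn (unitaryStabilizer x v) 1 (adj D * D⁻¹) := by
  let P : ℂ → Mat n := fun t => 1 - t • (1 - D)
  have hadj : ∀ t, adj (P t) = 1 - t • (1 - adj D) := by
    intro t
    simp [P, adj_sub, adj_smul, adj_one]
  -- `det (P t)` is the reversed characteristic polynomial of `1 - D`, whose value at `0` is `1`
  have hfin : {t : ℂ | (P t).det = 0}.Finite := by
    have hne : (1 - D).charpolyRev ≠ 0 := by
      intro h
      have := Matrix.eval_charpolyRev (M := 1 - D)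
      rw [h] at this
      simp at this
    refine (Polynomial.finite_setOfPred_isRoot hne).subset fun t ht => ?_
    have hmap : ((1 : Matrix _ _ ℂ[X]) - (X : ℂ[X]) • (1 - D).map C).map (evalRingHom t) = P t := by
      ext i j
      rcases eq_or_ne i j with hij | hij
      · simp [hij, P]
      · simp [hij, P]
        ring
    change eval t (1 - D).charpolyRev = 0
    rw [Matrix.charpolyRev, ← coe_evalRingHom, RingHom.map_det, RingHom.mapMatrix_apply, hmap]
    exact ht
  have hΩ : IsPathConnected {t : ℂ | (P t).det = 0}ᶜ :=
    hfin.countable.isPathConnected_compl_of_one_lt_rank (by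
      rw [Complex.rank_real_complex]; norm_num)
  have hcP : Continuous P := by fun_prop
  have hcQ : Continuous fun t => adj (P t) := by
    simp only [hadj]
    fun_prop
  have hcont : ContinuousOn (fun t => adj (P t) * (P t)⁻¹) {t : ℂ | (P t).det = 0}ᶜ := by
    refine hcQ.continuousOn.mul ?_
    simp only [Matrix.inv_def, Ring.inverse_eq_inv']
    exact (hcP.matrix_det.continuousOn.inv₀ fun t ht => ht).smul hcP.matrix_adjugate.continuousOn
  have hj := (hΩ.joinedIn 0 (by simp [P]) 1 (by simpa [P] using hD)).map_continuousOn hcont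
  have h0 : adj (P 0) * (P 0)⁻¹ = 1 := by simp [P, adj_one]
  have h1 : P 1 = D := by simp [P]
  simp only [h0, h1] at hj
  refine hj.mono ?_
  rintro _ ⟨t, ht, rfl⟩
  refine adj_mul_inv_mem hx (isUnit_iff_ne_zero.2 ht) ?_ ?_ ?_
  · simp only [P, sub_mul, mul_sub, smul_mul_assoc, mul_smul_comm, one_mul, mul_one, hDx]
  · rw [hadj]
    simp only [P, sub_mul, mul_sub, smul_mul_assoc, mul_smul_comm, one_mul, mul_one, hDD]
    module
  · rw [hadj]
    simp only [P, Matrix.sub_mulVec, Matrix.smul_mulVec, Matrix.one_mulVec, hv]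

lemma isUnit_det_of_mulVec_eq_zero {A : Mat n} (h : ∀ u, A *ᵥ u = 0 → u = 0) :
    IsUnit A.det := by
  rw [isUnit_iff_ne_zero]
  intro h0
  obtain ⟨u, hu, hAu⟩ := Matrix.exists_mulVec_eq_zero_iff.2 h0
  exact hu (h u hAu)

/-- The involution that is `-1` on the image of a self-adjoint projection `π` and `1` on its kernel
is joined to `1`. A symmetric form on the image of `π` for which `x` is self-adjoint differs from
the symplectic form by an invertible skew-adjoint operator `a` commuting with `x`, and the
involution is `D* D⁻¹` for `D = (1 - π) + a`. -/
theorem joinedIn_one_reflection {x π : Mat n} {v : V₁ n} (hx : adj x = x) (hππ : π * π = π)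
    (hπ : adj π = π) (hπx : π * x = x * π) (hπv : π *ᵥ v = 0) :
    JoinedIn (unitaryStabilizer x v) 1 (1 - 2 • π) := by
  obtain ⟨S, hS, hxS, hSπ, hSker⟩ := exists_symm_matrix_selfAdjoint hππ hπx
  obtain ⟨a, ha⟩ : ∃ a, a = Matrix.J (Fin n) ℂ * S := ⟨_, rfl⟩
  have hadja : adj a = -a := by rw [ha, adj_J_mul hS]
  have haπ : a * π = a := by rw [ha, mul_assoc, hSπ]
  have hπa : π * a = a := by
    have := congrArg adj haπ
    rw [adj_mul, hπ, hadja, mul_neg, neg_inj] at this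
    exact this
  have hax : a * x = x * a := by
    have hJx : Matrix.J (Fin n) ℂ * xᵀ = x * Matrix.J (Fin n) ℂ := by
      conv_rhs => rw [← hx, adj]
      simp [mul_assoc, Matrix.J_squared]
    rw [ha, mul_assoc, ← hxS, ← mul_assoc, hJx, mul_assoc]
  have haker : ∀ u, a *ᵥ u = 0 → π *ᵥ u = 0 := by
    intro u hu
    apply hSker
    have := congrArg (fun w => Matrix.J (Fin n) ℂ *ᵥ w) hu
    simpa [ha, Matrix.mulVec_mulVec, J_mul_J_mul, Matrix.neg_mulVec] using this
  have hadjD : adj (1 - π + a) = 1 - π - a := by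
    rw [adj_add, adj_sub, adj_one, hπ, hadja, sub_eq_add_neg (1 - π)]
  have hav : a *ᵥ v = 0 := by rw [← haπ, ← Matrix.mulVec_mulVec, hπv, Matrix.mulVec_zero]
  have hunit : IsUnit (1 - π + a).det := by
    refine isUnit_det_of_mulVec_eq_zero fun u hu => ?_
    have h1 : a *ᵥ u = 0 := by
      have h := congrArg (fun w => π *ᵥ w) hu
      simpa [Matrix.mulVec_mulVec, mul_add, mul_sub, hππ, hπa] using h
    simpa [Matrix.add_mulVec, Matrix.sub_mulVec, h1, haker u h1] using hu
  have hmul : adj (1 - π + a) * (1 - π + a)⁻¹ = 1 - 2 • π := by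
    have h : (1 - 2 • π) * (1 - π + a) = adj (1 - π + a) := by
      rw [hadjD]
      simp only [sub_mul, mul_add, mul_sub, one_mul, mul_one, smul_mul_assoc, hππ, hπa]
      module
    rw [← h, mul_assoc, Matrix.mul_nonsing_inv _ hunit, mul_one]
  rw [← hmul]
  refine joinedIn_one_adj_mul_inv hx hunit ?_ ?_ ?_
  · simp only [add_mul, sub_mul, mul_add, mul_sub, one_mul, mul_one, hπx, hax]
  · rw [hadjD]
    simp only [add_mul, sub_mul, mul_add, mul_sub, one_mul, mul_one, hππ, hπa, haπ]
    module
  · rw [hadjD]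
    simp only [Matrix.add_mulVec, Matrix.sub_mulVec, hav, add_zero, sub_zero]

/-- The Cayley transform: `k = D* D⁻¹` with `D = 1 + k⁻¹`, provided `-1` is not an eigenvalue
of `k`. -/
theorem joinedIn_one_of_det_one_add {x k : Mat n} {v : V₁ n} (hx : adj x = x)
    (hk : k ∈ unitaryStabilizer x v) (hdet : IsUnit (1 + k).det) :
    JoinedIn (unitaryStabilizer x v) 1 k := by
  obtain ⟨hk1, hkx, hkv⟩ := hk
  have hk2 : adj k * k = 1 := mul_eq_one_comm.1 hk1
  have hadjD : adj (1 + adj k) = 1 + k := by rw [adj_add, adj_one, adj_adj]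
  have hD : k * (1 + adj k) = 1 + k := by rw [mul_add, mul_one, hk1, add_comm]
  have hunit : IsUnit (1 + adj k).det := by
    rw [← hD, Matrix.det_mul] at hdet
    exact isUnit_of_mul_isUnit_right hdet
  have hmul : adj (1 + adj k) * (1 + adj k)⁻¹ = k := by
    rw [hadjD, ← hD, mul_assoc, Matrix.mul_nonsing_inv _ hunit, mul_one]
  have hadjx : adj k * x = x * adj k := by
    have := congrArg adj hkx
    rw [adj_mul, adj_mul, hx] at this
    exact this.symm
  have hadjv : adj k *ᵥ v = v := by
    conv_lhs => rw [← hkv]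
    rw [Matrix.mulVec_mulVec, hk2, Matrix.one_mulVec]
  have := joinedIn_one_adj_mul_inv (v := v) hx hunit
    (by rw [add_mul, mul_add, hadjx, one_mul, mul_one])
    (by rw [hadjD]; simp only [add_mul, mul_add, one_mul, mul_one, hk1, hk2]; abel)
    (by rw [hadjD, Matrix.add_mulVec, Matrix.add_mulVec, hadjv, hkv])
  rwa [hmul] at this

/-- Every `g` in the stabilizer is joined to `1`: changing the sign of `g` on its generalized
eigenspace for `-1`, where `v` has no component, removes the eigenvalue `-1`. -/
theorem joinedIn_one {x g : Mat n} {v : V₁ n} (hx : adj x = x)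
    (hg : g ∈ unitaryStabilizer x v) : JoinedIn (unitaryStabilizer x v) 1 g := by
  have hgs := hg
  obtain ⟨hg1, hgx, hgv⟩ := hg
  have hg2 : adj g * g = 1 := mul_eq_one_comm.1 hg1
  have hadjx : adj g * x = x * adj g := by
    have := congrArg adj hgx
    rw [adj_mul, adj_mul, hx] at this
    exact this.symm
  have hinv : ∀ (c : ℂ) u, c * c = 1 → g *ᵥ u = c • u → adj g *ᵥ u = c • u := by
    intro c u hc hu
    have h := congrArg (fun w => c • (adj g *ᵥ w)) hu
    simp only [Matrix.mulVec_mulVec, hg2, Matrix.one_mulVec, Matrix.mulVec_smul, smul_smul, hc,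
      one_smul] at h
    exact h.symm
  -- `y = g⁻¹ (1 + g)²` is self-adjoint, and so is every polynomial in it; its generalized kernel
  -- is the generalized eigenspace of `g` for `-1`
  obtain ⟨y, hy⟩ : ∃ y, y = g + adj g + 2 • (1 : Mat n) := ⟨_, rfl⟩
  have hyeig : ∀ (c : ℂ) u, c * c = 1 → g *ᵥ u = c • u → y *ᵥ u = (2 * c + 2) • u := by
    intro c u hc hu
    rw [hy, Matrix.add_mulVec, Matrix.add_mulVec, hu, hinv c u hc hu, Matrix.smul_mulVec,
      Matrix.one_mulVec]
    module
  have hyadj : adj y = y := by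
    rw [hy, two_smul, adj_add, adj_add, adj_add, adj_adj, adj_one]
    abel
  have hyx : Commute x y := by
    simp only [hy, Commute, SemiconjBy, mul_add, add_mul, hgx, hadjx, mul_smul_comm, smul_mul_assoc,
      mul_one, one_mul]
  have hyg : Commute g y := by
    simp only [hy, Commute, SemiconjBy, mul_add, add_mul, hg1, hg2, mul_smul_comm, smul_mul_assoc,
      mul_one, one_mul]
  obtain ⟨p, c, hππ, ⟨N, hN⟩, hc⟩ := exists_fitting_projection (K := ℂ) y
  have hπadj := adj_aeval hyadj p
  have hcomm : ∀ z, Commute z y → Commute z (aeval y p) := by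
    intro z hz
    rw [aeval_eq_sum_range]
    exact Commute.sum_right _ _ _ fun i _ => (hz.pow_right i).smul_right _
  have hπx : aeval y p * x = x * aeval y p := (hcomm x hyx).symm
  have hπg : aeval y p * g = g * aeval y p := (hcomm g hyg).symm
  have hNπ : aeval y p * y ^ N = 0 := by
    rw [← ((hcomm y (Commute.refl y)).pow_left N).eq, hN]
  generalize aeval y p = π at *
  have hfix : ∀ u, g *ᵥ u = u → y ^ N *ᵥ u = (4 : ℂ) ^ N • u := by
    intro u hu
    have h4 : y *ᵥ u = (4 : ℂ) • u := by
      rw [hyeig 1 u (by norm_num) (by rw [hu, one_smul])]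
      norm_num
    generalize N = N
    induction N with
    | zero => simp
    | succ N ih => rw [pow_succ, ← Matrix.mulVec_mulVec, h4, Matrix.mulVec_smul, ih, smul_smul,
        pow_succ, mul_comm]
  have h4N : (4 : ℂ) ^ N ≠ 0 := pow_ne_zero _ (by norm_num)
  have hπv : π *ᵥ v = 0 := by
    have h := congrArg (fun w => π *ᵥ w) (hfix v hgv)
    simp only [Matrix.mulVec_mulVec, hNπ, Matrix.zero_mulVec, Matrix.mulVec_smul] at h
    exact (smul_eq_zero.1 h.symm).resolve_left h4N
  have hε := joinedIn_one_reflection hx hππ hπadj hπx hπv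
  have hεε : (1 - 2 • π) * (1 - 2 • π) = 1 := by
    simp only [sub_mul, mul_sub, one_mul, mul_one, smul_mul_assoc, mul_smul_comm, hππ]
    module
  have hk : g * (1 - 2 • π) ∈ unitaryStabilizer x v :=
    mul_mem_unitaryStabilizer hgs hε.target_mem
  have hkdet : IsUnit (1 + g * (1 - 2 • π)).det := by
    refine isUnit_det_of_mulVec_eq_zero fun u hu => ?_
    -- on the image of `π`, where `y` is nilpotent, `π u` would be an eigenvector of `g` for `1`,
    -- but there `y` acts as `4`
    have hgπ : g *ᵥ (π *ᵥ u) = π *ᵥ u := by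
      have h := congrArg (fun w => π *ᵥ w) hu
      have hmat : π * (1 + g * (1 - 2 • π)) = π - g * π := by
        rw [mul_add, ← mul_assoc, hπg]
        simp only [mul_sub, mul_smul_comm, mul_assoc, hππ, mul_one]
        module
      simp only [Matrix.mulVec_mulVec, hmat, Matrix.sub_mulVec, Matrix.mulVec_zero] at h
      rw [Matrix.mulVec_mulVec]
      exact (sub_eq_zero.1 h).symm
    have hπu : π *ᵥ u = 0 := by
      have h := hfix _ hgπ
      rw [Matrix.mulVec_mulVec, hN, Matrix.zero_mulVec] at h
      exact (smul_eq_zero.1 h.symm).resolve_left h4N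
    -- so `u` lies in the kernel of `π`, where `y` is invertible, and is an eigenvector for `-1`
    have hgu : g *ᵥ u = (-1 : ℂ) • u := by
      rw [Matrix.add_mulVec, ← Matrix.mulVec_mulVec, Matrix.sub_mulVec, Matrix.smul_mulVec, hπu,
        smul_zero, sub_zero, Matrix.one_mulVec] at hu
      rw [neg_one_smul]
      exact eq_neg_of_add_eq_zero_right hu
    have hyu : y *ᵥ u = 0 := by
      rw [hyeig (-1) u (by norm_num) hgu]
      norm_num
    have h := congrArg (fun A => A *ᵥ u) hc
    simpa [Matrix.sub_mulVec, hπu, ← Matrix.mulVec_mulVec, hyu] using h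
  have h1k := joinedIn_one_of_det_one_add hx hk hkdet
  have hkg : JoinedIn (unitaryStabilizer x v) (g * (1 - 2 • π)) g := by
    have h := hε.map (f := fun A => g * (1 - 2 • π) * A) (by fun_prop)
    simp only [mul_one, mul_assoc, hεε] at h
    refine h.mono ?_
    rintro _ ⟨A, hA, rfl⟩
    have hkA := mul_mem_unitaryStabilizer hk hA
    rwa [mul_assoc] at hkA
  exact h1k.trans hkg

theorem isPathConnected_unitaryStabilizer {x : Mat n} (v : V₁ n) (hx : adj x = x) :
    IsPathConnected (unitaryStabilizer x v) :=
  ⟨1, one_mem_unitaryStabilizer x v, fun {_} hg => joinedIn_one hx hg⟩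

/-! ### Bivectors as matrices -/

/-- The coefficient matrix of a bivector: `v ∧ w` goes to the skew-symmetric matrix
`v wᵀ - w vᵀ`, whose entries are the `2 × 2` minors of `v` and `w`. -/
noncomputable def toMat (n : ℕ) : ⋀[ℂ]^2 (V₁ n) →ₗ[ℂ] Mat n :=
  LinearMap.pi fun a => LinearMap.pi fun b =>
    exteriorPower.alternatingMapLinearEquiv
      ((Matrix.detRowAlternating (n := Fin 2) (R := ℂ)).compLinearMap
        (LinearMap.funLeft ℂ ℂ ![a, b]))

lemma toMat_wedge (v w : V₁ n) :
    toMat n (wedge v w) = Matrix.vecMulVec v w - Matrix.vecMulVec w v := by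
  ext a b
  change exteriorPower.alternatingMapLinearEquiv _ (exteriorPower.ιMulti ℂ 2 ![v, w]) = _
  rw [exteriorPower.alternatingMapLinearEquiv_apply_ιMulti]
  change Matrix.det (Matrix.of fun i : Fin 2 => LinearMap.funLeft ℂ ℂ ![a, b] (![v, w] i)) = _
  rw [Matrix.det_fin_two]
  simp [LinearMap.funLeft_apply, Matrix.vecMulVec_apply]
  ring

lemma linearMap_ext_wedge {M : Type*} [AddCommGroup M] [Module ℂ M]
    {f g : ⋀[ℂ]^2 (V₁ n) →ₗ[ℂ] M} (h : ∀ v w, f (wedge v w) = g (wedge v w)) : f = g := by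
  refine exteriorPower.linearMap_ext (AlternatingMap.ext fun u => ?_)
  have hu : u = ![u 0, u 1] := by
    funext i
    fin_cases i <;> rfl
  rw [hu]
  exact h (u 0) (u 1)

lemma toMat_transpose (Y : ⋀[ℂ]^2 (V₁ n)) : (toMat n Y)ᵀ = -toMat n Y := by
  have h : (Matrix.transposeLinearEquiv _ _ ℂ ℂ).toLinearMap ∘ₗ toMat n = -toMat n :=
    linearMap_ext_wedge fun v w => by
      simp [toMat_wedge, Matrix.transpose_vecMulVec]
  exact LinearMap.congr_fun h Y

lemma toMat_ρΛ (g : G n) (Y : ⋀[ℂ]^2 (V₁ n)) :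
    toMat n (ρΛ n g Y) = g.1 * toMat n Y * g.1ᵀ := by
  have h : toMat n ∘ₗ ρΛ n g =
      LinearMap.mulRight ℂ g.1ᵀ ∘ₗ LinearMap.mulLeft ℂ g.1 ∘ₗ toMat n :=
    linearMap_ext_wedge fun v w => by
      have hρ : ∀ u, ρ₁ n g u = g.1 *ᵥ u := fun u => rfl
      simp [toMat_wedge, ρΛ_wedge, hρ, mul_sub, sub_mul, Matrix.mul_vecMulVec,
        Matrix.vecMulVec_mul, Matrix.vecMul_transpose]
  exact LinearMap.congr_fun h Y

lemma toMat_ω : toMat n (ω n) = -Matrix.J (Fin n) ℂ := by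
  have h := sum_J_wedge n
  have h2 := congrArg (toMat n) h
  simp only [map_sum, map_smul, toMat_wedge] at h2
  have h3 : ∑ a, ∑ b, Matrix.J (Fin n) ℂ a b •
      (Matrix.vecMulVec (e a) (e b) - Matrix.vecMulVec (e b) (e a)) =
      (2 : ℂ) • Matrix.J (Fin n) ℂ := by
    have hskew : ∀ a b, Matrix.J (Fin n) ℂ b a = - Matrix.J (Fin n) ℂ a b := fun a b => by
      have := congrFun (congrFun (Matrix.J_transpose (Fin n) ℂ) a) b
      simpa using this
    ext a b
    simp only [Matrix.sum_apply, Matrix.smul_apply, Matrix.sub_apply, Matrix.vecMulVec_apply, e,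
      Pi.single_apply, smul_eq_mul, mul_sub, Finset.sum_sub_distrib, mul_ite, mul_one,
      mul_zero, Finset.sum_ite_eq, Finset.mem_univ, if_true, hskew a b,
      Finset.sum_ite_irrel, Finset.sum_const_zero]
    ring
  rw [h3] at h2
  have h4 : (-2 : ℂ) • toMat n (ω n) = (-2 : ℂ) • (-Matrix.J (Fin n) ℂ) := by
    rw [← h2]
    module
  exact smul_right_injective _ (by norm_num : (-2 : ℂ) ≠ 0) h4

lemma wedge_eq_sum (v w : V₁ n) :
    wedge v w = ∑ a, ∑ b, (v a * w b) • wedge (e a) (e b) := by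
  have he : ∀ u : V₁ n, u = ∑ a, u a • e a := fun u => by
    ext b
    simp [e, Pi.single_apply]
  conv_lhs => rw [he v, he w, ← wedgeₗ_apply]
  simp only [map_sum, map_smul, LinearMap.sum_apply, LinearMap.smul_apply, wedgeₗ_apply,
    Finset.smul_sum, smul_smul]
  rw [Finset.sum_comm]
  exact Finset.sum_congr rfl fun a _ => Finset.sum_congr rfl fun b _ => by rw [mul_comm]

lemma toMat_injective : Function.Injective (toMat n) := by
  -- twice a left inverse of `toMat`
  let r : Mat n →ₗ[ℂ] ⋀[ℂ]^2 (V₁ n) :=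
    ∑ a, ∑ b, (LinearMap.proj b ∘ₗ LinearMap.proj a : Mat n →ₗ[ℂ] ℂ).smulRight
      (wedge (e a) (e b))
  have hr : ∀ A, r A = ∑ a, ∑ b, A a b • wedge (e a) (e b) := fun A => by
    simp only [r, LinearMap.sum_apply]
    rfl
  have h : r ∘ₗ toMat n = (2 : ℂ) • LinearMap.id := linearMap_ext_wedge fun v w => by
    rw [LinearMap.comp_apply, toMat_wedge, map_sub, hr, hr]
    simp only [Matrix.vecMulVec_apply]
    rw [← wedge_eq_sum, ← wedge_eq_sum, wedge_swap v w, LinearMap.smul_apply, LinearMap.id_apply]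
    module
  intro Y Z hYZ
  have hY := LinearMap.congr_fun h Y
  have hZ := LinearMap.congr_fun h Z
  rw [LinearMap.comp_apply, hYZ, ← LinearMap.comp_apply, hZ] at hY
  exact (smul_right_injective _ (two_ne_zero (α := ℂ)) hY).symm

/-- Multiplication by `J` turns skew-symmetric matrices into self-adjoint endomorphisms. -/
lemma adj_toMat_mul_J (Y : ⋀[ℂ]^2 (V₁ n)) :
    adj (toMat n Y * Matrix.J (Fin n) ℂ) = toMat n Y * Matrix.J (Fin n) ℂ := by
  simp [adj, Matrix.transpose_mul, toMat_transpose, J_mul_J_mul]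

lemma toMat_ρΛ_mul_J (g : G n) (Y : ⋀[ℂ]^2 (V₁ n)) :
    toMat n (ρΛ n g Y) * Matrix.J (Fin n) ℂ =
      g.1 * (toMat n Y * Matrix.J (Fin n) ℂ) * adj g.1 := by
  rw [toMat_ρΛ, adj]
  simp only [mul_neg, mul_assoc, J_mul_J_mul, neg_neg]

/-- An element of `V₂` is a self-adjoint endomorphism up to a scalar. Its stabilizer is nevertheless
the centralizer of the endomorphism, because conjugation preserves the trace. -/
lemma ρ₂_mk_eq_iff (g : G n) (Y : ⋀[ℂ]^2 (V₁ n)) :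
    ρ₂ n g (Submodule.Quotient.mk Y) = Submodule.Quotient.mk Y ↔
      g.1 * (toMat n Y * Matrix.J (Fin n) ℂ) = toMat n Y * Matrix.J (Fin n) ℂ * g.1 := by
  have h1 : g.1 * adj g.1 = 1 := mem_symplecticGroup_iff_mul_adj.1 g.2
  have h2 : adj g.1 * g.1 = 1 := mul_eq_one_comm.1 h1
  change Submodule.Quotient.mk (ρΛ n g Y) = _ ↔ _
  rw [Submodule.Quotient.eq, Submodule.mem_span_singleton]
  have hJ := toMat_ρΛ_mul_J g Y
  constructor
  · rintro ⟨c, hc⟩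
    have hcJ : g.1 * (toMat n Y * Matrix.J (Fin n) ℂ) * adj g.1 -
        toMat n Y * Matrix.J (Fin n) ℂ = c • 1 := by
      rw [← hJ, ← sub_mul, ← map_sub, ← hc, map_smul, toMat_ω, smul_mul_assoc, neg_mul,
        Matrix.J_squared, neg_neg]
    have htr : c * (Fintype.card (Fin n ⊕ Fin n) : ℂ) = 0 := by
      have h := congrArg Matrix.trace hcJ
      rw [Matrix.trace_sub, Matrix.trace_mul_comm, ← mul_assoc, h2, one_mul, sub_self,
        Matrix.trace_smul, Matrix.trace_one, smul_eq_mul] at h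
      exact h.symm
    have hc1 : c • (1 : Mat n) = 0 := by
      rcases mul_eq_zero.1 htr with h | h
      · rw [h, zero_smul]
      -- the case `n = 0`, where all matrices are equal
      · have := Fintype.card_eq_zero_iff.1 (Nat.cast_eq_zero.1 h)
        exact Subsingleton.elim _ _
    rw [hc1, sub_eq_zero] at hcJ
    conv_rhs => rw [← hcJ]
    rw [mul_assoc _ (adj g.1), h2, mul_one]
  · intro h
    refine ⟨0, ?_⟩
    rw [h, mul_assoc, h1, mul_one] at hJ
    have hM := congrArg (fun A => A * Matrix.J (Fin n) ℂ) hJ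
    simp only [mul_assoc, Matrix.J_squared, mul_neg, mul_one, neg_inj] at hM
    rw [toMat_injective hM, zero_smul, sub_self]

/-! ### Stabilizers of points of `𝕍` -/

lemma image_stabilizer (v : V₁ n) (Y : ⋀[ℂ]^2 (V₁ n)) :
    Subtype.val '' (stabilizer ((v, Submodule.Quotient.mk Y) : V n) : Set (G n)) =
      unitaryStabilizer (toMat n Y * Matrix.J (Fin n) ℂ) v := by
  have hmem : ∀ g : G n, g ∈ (stabilizer ((v, Submodule.Quotient.mk Y) : V n) : Set (G n)) ↔
      g.1 *ᵥ v = v ∧ ρ₂ n g (Submodule.Quotient.mk Y) = Submodule.Quotient.mk Y :=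
    fun g => Prod.mk_inj
  ext A
  constructor
  · rintro ⟨g, hg, rfl⟩
    rw [hmem, ρ₂_mk_eq_iff] at hg
    exact ⟨mem_symplecticGroup_iff_mul_adj.1 g.2, hg.2, hg.1⟩
  · rintro ⟨h1, h2, h3⟩
    refine ⟨⟨A, mem_symplecticGroup_iff_mul_adj.2 h1⟩, ?_, rfl⟩
    rw [hmem, ρ₂_mk_eq_iff]
    exact ⟨h3, h2⟩

theorem isPathConnected_stabilizer (X : V n) :
    IsPathConnected (stabilizer X : Set (G n)) := by
  obtain ⟨v, q⟩ := X
  obtain ⟨Y, rfl⟩ := Submodule.Quotient.mk_surjective _ q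
  rw [Topology.IsInducing.subtypeVal.isPathConnected_iff, image_stabilizer]
  exact isPathConnected_unitaryStabilizer v (adj_toMat_mul_J Y)

/-- The Zariski topology is coarser than the classical one. -/
lemma le_zariski (n : ℕ) : (inferInstance : TopologicalSpace (G n)) ≤ zariski n := by
  refine le_generateFrom ?_
  rintro _ ⟨p, rfl⟩
  refine isOpen_ne.preimage ((MvPolynomial.continuous_eval p).comp ?_)
  exact continuous_pi fun ab => continuous_subtype_val.matrix_elem ab.1 ab.2

end ExoticNilpotentCone

/-- The stabilizer in `Sp(2n, ℂ)` of every point of the exotic nilpotent cone is connected, both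
in the classical topology of `Sp(2n, ℂ)` (the subspace topology from complex matrices) and in its
Zariski topology. -/
theorem corollary6p2 (n : ℕ) (X : ExoticNilpotentCone.V n)
    (hX : X ∈ ExoticNilpotentCone.nilcone n) :
    IsConnected (ExoticNilpotentCone.stabilizer X : Set (ExoticNilpotentCone.G n)) ∧
      ExoticNilpotentCone.IsZariskiConnected
        (ExoticNilpotentCone.stabilizer X : Set (ExoticNilpotentCone.G n)) := by
  have h := (ExoticNilpotentCone.isPathConnected_stabilizer X).isConnected
  exact ⟨h, h.nonempty, fun u w hu hw => h.isPreconnected u w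
    (ExoticNilpotentCone.le_zariski n u hu) (ExoticNilpotentCone.le_zariski n w hw)⟩
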